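/- Let $\mathbf{H}^2$ be the hyperbolic plane (curvature $-1$), on which $\mathrm{PSL}(2,\mathbf{Z})$ acts by Möbius transformations, and let $X=\mathbf{H}^2/\mathrm{PSL}(2,\mathbf{Z})$ be the modular surface. Call $\gamma\in\mathrm{PSL}(2,\mathbf{Z})$ primitive if $\gamma\neq\eta^m$ for all $\eta\in\mathrm{PSL}(2,\mathbf{Z})$ and all integers $m\ge 2$. The primitive length spectrum $\mathcal{L}_p(X)$ is the set of lengths of closed orbifold geodesics on $X$ representing conjugacy classes of primitive elements, that is, the set of real $L>0$ for which there are a primitive $\gamma\in\mathrm{PSL}(2,\mathbf{Z})$ and a complete unit-speed geodesic $c\colon\mathbf{R}\to\mathbf{H}^2$ with $\gamma\cdot c(t)=c(t+L)$ for all $t\in\mathbf{R}$. Then for every $\ell\in\mathcal{L}_p(X)$ and every $k\in\mathbf{N}$ there is a positive integer $C_{\ell,k}$ such that \[ \{\,C_{\ell,k}\,n\,\ell : n=1,\dots,k\,\}\subset\mathcal{L}_p(X). \] -/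

import Mathlib

open scoped MatrixGroups UpperHalfPlane

namespace ModularSurface

/-- Central elements `±1` of `SL(2, ℤ)` act trivially on the upper half plane. -/
theorem smul_eq_of_mem_center {g : SL(2, ℤ)} (hg : g ∈ Subgroup.center SL(2, ℤ)) (z : ℍ) :
    g • z = z := by
  obtain ⟨r, hr, hrg⟩ := Matrix.SpecialLinearGroup.mem_center_iff.mp hg
  have hr2 : r = 1 ∨ r = -1 := by simpa using hr
  rcases hr2 with rfl | rfl
  · have : g = 1 := by ext i j; simp [← hrg]
    rw [this, one_smul]
  · have : g = -1 := by ext i j; simp [← hrg]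
    rw [this, ModularGroup.SL_neg_smul, one_smul]

/-- The homomorphism from `PSL(2, ℤ)` to the permutations of `ℍ` induced by Möbius
transformations. -/
noncomputable def pslToPerm : PSL(2, ℤ) →* Equiv.Perm ℍ :=
  QuotientGroup.lift (Subgroup.center SL(2, ℤ)) (MulAction.toPermHom SL(2, ℤ) ℍ)
    (fun _ hg => Equiv.ext fun z => smul_eq_of_mem_center hg z)

/-- `PSL(2, ℤ)` acts on the hyperbolic plane `ℍ` by Möbius transformations. The quotient orbifold
`X = ℍ / PSL(2, ℤ)` is the modular surface, with orbifold fundamental group `PSL(2, ℤ)`. -/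
noncomputable instance pslAction : MulAction PSL(2, ℤ) ℍ :=
  MulAction.compHom ℍ pslToPerm

theorem coe_smul (g : SL(2, ℤ)) (z : ℍ) : (g : PSL(2, ℤ)) • z = g • z := rfl

/-- A complete unit-speed geodesic of the hyperbolic plane. Geodesics of `ℍ` minimize length
globally, so these are exactly the isometric embeddings of the real line, `ℍ` carrying the
hyperbolic distance of curvature `-1`. -/
def IsGeodesicLine (c : ℝ → ℍ) : Prop := Isometry c

/-- The set of lengths of the closed orbifold geodesics of `X` that represent the conjugacy class
of `γ`. A closed orbifold geodesic of length `L > 0` representing the class of `γ` is the image in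
`X` of a unit-speed geodesic line `c` of the universal cover `ℍ` with `γ • c t = c (t + L)`.
Replacing `c` by `δ • c` replaces `γ` by `δ * γ * δ⁻¹`, so the set only depends on the conjugacy
class of `γ`. It is empty when `γ` is not hyperbolic. -/
def closedGeodesicLengths (γ : PSL(2, ℤ)) : Set ℝ :=
  {L | 0 < L ∧ ∃ c : ℝ → ℍ, IsGeodesicLine c ∧ ∀ t : ℝ, γ • c t = c (t + L)}

/-- `γ` is primitive: it is not a proper power of an element of the group. An element of finite
order `n` is never primitive, being its own `(n + 1)`-st power. -/
def IsPrimitiveElement {G : Type*} [Group G] (γ : G) : Prop :=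
  ∀ (η : G) (m : ℕ), 2 ≤ m → η ^ m ≠ γ

/-- The underlying set of the primitive length spectrum of the modular surface: the union of the
sets of lengths over all primitive conjugacy classes of `PSL(2, ℤ)`. -/
def primitiveLengthSpectrum : Set ℝ :=
  {L | ∃ γ : PSL(2, ℤ), IsPrimitiveElement γ ∧ L ∈ closedGeodesicLengths γ}

end ModularSurface

/-!
An element `g` of `SL(2, ℤ)` translating a geodesic is hyperbolic, so its lower left entry is
nonzero and `g` is conjugate over `ℝ` to the companion matrix of `X ^ 2 - (tr g) X + 1`. That matrix
is again integral, and it translates geodesics by the same lengths because `GL(2, ℝ)` acts on `ℍ` by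
isometries. It is moreover primitive: the lower left entry of `A ^ (n + 1)` is that of `A` times
`Sₙ(tr A)`, where `Sₙ` is the rescaled Chebyshev polynomial of the second kind, and for `A`
hyperbolic and `0 < n` this factor has absolute value at least `2`, while the companion matrix has
lower left entry `1`. Hence every length of a closed geodesic is a primitive length. Applied to
`γ ^ n`, this gives all the multiples `n ℓ`, so that `C = 1` works.
-/

namespace ModularSurface

open Matrix SpecialLinearGroup
open Polynomial (C aeval)
open Polynomial.Chebyshev (S)

section Powers

variable {R : Type*} [CommRing R]

theorem discr_map {R' : Type*} [CommRing R'] (f : R →+* R') (A : Matrix (Fin 2) (Fin 2) R) :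
    (A.map f).discr = f A.discr := by
  simp [discr_fin_two, trace_fin_two, det_fin_two, map_ofNat f 4]

theorem discr_smul_sub_smul_one (A : Matrix (Fin 2) (Fin 2) R) (u v : R) :
    (u • A - v • (1 : Matrix (Fin 2) (Fin 2) R)).discr = u ^ 2 * A.discr := by
  simp only [discr_fin_two, trace_fin_two, det_fin_two, Matrix.sub_apply, Matrix.smul_apply,
    smul_eq_mul, one_apply_eq, one_apply_ne zero_ne_one, one_apply_ne one_ne_zero]
  ring

theorem mul_self_eq_trace_smul_sub_det_smul (A : Matrix (Fin 2) (Fin 2) R) :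
    A * A = A.trace • A - A.det • (1 : Matrix (Fin 2) (Fin 2) R) := by
  ext i j
  fin_cases i <;> fin_cases j <;>
    simp [Matrix.mul_apply, Fin.sum_univ_two, trace_fin_two, det_fin_two] <;> ring

variable {A : Matrix (Fin 2) (Fin 2) R}

theorem pow_succ_eq_eval_S_smul_sub (hA : A.det = 1) (n : ℕ) :
    A ^ (n + 1) = (S R n).eval A.trace • A -
      (S R (n - 1)).eval A.trace • (1 : Matrix (Fin 2) (Fin 2) R) := by
  induction n with
  | zero => simp
  | succ n ih =>
    have hS : (S R (n + 1)).eval A.trace =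
        A.trace * (S R n).eval A.trace - (S R (n - 1)).eval A.trace := by
      simp [Polynomial.Chebyshev.S_add_one]
    rw [pow_succ, ih, sub_mul, smul_mul_assoc, mul_self_eq_trace_smul_sub_det_smul, hA]
    push_cast
    rw [hS, add_sub_cancel_right, smul_mul_assoc, one_mul]
    module

theorem pow_succ_apply_one_zero (hA : A.det = 1) (n : ℕ) :
    (A ^ (n + 1)) 1 0 = (S R n).eval A.trace * A 1 0 := by
  simp [pow_succ_eq_eval_S_smul_sub hA]

theorem discr_pow_succ (hA : A.det = 1) (n : ℕ) :
    (A ^ (n + 1)).discr = (S R n).eval A.trace ^ 2 * A.discr := by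
  rw [pow_succ_eq_eval_S_smul_sub hA, discr_smul_sub_smul_one]

variable [LinearOrder R] [IsStrictOrderedRing R]

theorem strictMono_abs_eval_S {t : R} (ht : 2 < |t|) :
    StrictMono fun n : ℕ => |(S R n).eval t| := by
  refine strictMono_nat_of_lt_succ fun n => ?_
  induction n with
  | zero => simpa using one_lt_two.trans ht
  | succ n ih =>
    have hS : (S R (n + 2 : ℕ)).eval t = t * (S R (n + 1 : ℕ)).eval t - (S R n).eval t := by
      simp [Polynomial.Chebyshev.S_add_two]
    calc |(S R (n + 1 : ℕ)).eval t|
        < 2 * |(S R (n + 1 : ℕ)).eval t| - |(S R n).eval t| := by linarith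
      _ ≤ |t| * |(S R (n + 1 : ℕ)).eval t| - |(S R n).eval t| := by gcongr
      _ ≤ |(S R (n + 2 : ℕ)).eval t| := by
        rw [hS, ← abs_mul]
        exact abs_sub_abs_le_abs_sub _ _

theorem isHyperbolic_of_pow (hA : A.det = 1) {m : ℕ} (hm : m ≠ 0)
    (h : (A ^ m).IsHyperbolic) : A.IsHyperbolic := by
  obtain ⟨n, rfl⟩ := Nat.exists_eq_succ_of_ne_zero hm
  rw [IsHyperbolic, discr_pow_succ hA] at h
  exact pos_of_mul_pos_right h (sq_nonneg _)

theorem isHyperbolic_iff_two_lt_abs_trace (hA : A.det = 1) :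
    A.IsHyperbolic ↔ 2 < |A.trace| := by
  rw [IsHyperbolic, discr_fin_two, hA, mul_one, sub_pos, ← abs_two (α := R), ← sq_lt_sq]
  norm_num

end Powers

theorem not_isUnit_pow_apply_one_zero {A : Matrix (Fin 2) (Fin 2) ℤ} (hA : A.det = 1) {m : ℕ}
    (hm : 2 ≤ m) (h : (A ^ m).IsHyperbolic) : ¬ IsUnit ((A ^ m) 1 0) := by
  obtain ⟨n, rfl⟩ := Nat.exists_eq_add_of_le' (one_le_two.trans hm)
  have htrace : 2 < |A.trace| :=
    (isHyperbolic_iff_two_lt_abs_trace hA).mp (isHyperbolic_of_pow hA n.succ_ne_zero h)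
  have hS : 1 < |(S ℤ n).eval A.trace| := by
    simpa using strictMono_abs_eval_S htrace (show 0 < n by omega)
  rw [pow_succ_apply_one_zero hA]
  exact fun hu => hS.ne' (Int.isUnit_iff_abs_eq.mp (isUnit_of_mul_isUnit_left hu))

theorem psl_coe_eq_coe_iff {R : Type*} [CommRing R] [IsDomain R] {g h : SL(2, R)} :
    (g : PSL(2, R)) = h ↔ g = h ∨ g = -h := by
  rw [QuotientGroup.eq]
  constructor
  · intro hmem
    obtain ⟨r, hr, hrg⟩ := mem_center_iff.mp hmem
    rw [Fintype.card_fin, sq_eq_one_iff] at hr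
    rcases hr with rfl | rfl
    · have h_one : g⁻¹ * h = 1 := Subtype.ext (by simp [← hrg])
      exact .inl (inv_mul_eq_one.mp h_one)
    · have h_neg : g⁻¹ * h = -1 := Subtype.ext (by rw [← hrg, map_neg, map_one]; rfl)
      rw [inv_mul_eq_iff_eq_mul] at h_neg
      simp [h_neg]
  · rintro (rfl | rfl)
    · simp
    · have hneg : (-1 : SL(2, R)) ∈ Subgroup.center SL(2, R) :=
        Subgroup.mem_center_iff.mpr fun A => by simp
      simpa using hneg

theorem isPrimitiveElement_coe {g : SL(2, ℤ)} (hg : g.val.IsHyperbolic) (hc : IsUnit (g 1 0)) :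
    IsPrimitiveElement (g : PSL(2, ℤ)) := by
  intro η m hm h
  obtain ⟨E, rfl⟩ := QuotientGroup.mk_surjective η
  have hE : E ^ m = g ∨ E ^ m = -g := psl_coe_eq_coe_iff.mp h
  refine not_isUnit_pow_apply_one_zero E.det_coe hm ?_ ?_ <;>
    rw [← Matrix.SpecialLinearGroup.coe_pow] <;> rcases hE with hE | hE <;> rw [hE] <;> simpa

section Displacement

theorem fixpointPolynomial_mul_self {R : Type*} [CommRing R] (g : GL (Fin 2) R) :
    (g * g).fixpointPolynomial = C g.val.trace * g.fixpointPolynomial := by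
  simp only [GeneralLinearGroup.fixpointPolynomial, Units.val_mul, Matrix.mul_apply,
    Fin.sum_univ_two, trace_fin_two, map_add, map_mul, map_sub]
  ring

theorem norm_coe_gl_smul_sub_coe_gl_smul (g : GL (Fin 2) ℝ) (z w : ℍ) :
    ‖((g • z : ℍ) : ℂ) - (g • w : ℍ)‖ =
      |g.det.val| * ‖(z : ℂ) - w‖ / (‖UpperHalfPlane.denom g z‖ * ‖UpperHalfPlane.denom g w‖) := by
  have hz := UpperHalfPlane.denom_ne_zero g z
  have hw := UpperHalfPlane.denom_ne_zero g w
  have h : UpperHalfPlane.num g z / UpperHalfPlane.denom g z -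
      UpperHalfPlane.num g w / UpperHalfPlane.denom g w =
      (g.det.val : ℂ) * (z - w) / (UpperHalfPlane.denom g z * UpperHalfPlane.denom g w) := by
    rw [div_sub_div _ _ hz hw]
    congr 1
    simp only [UpperHalfPlane.num, UpperHalfPlane.denom, GeneralLinearGroup.val_det_apply,
      det_fin_two, Complex.ofReal_sub, Complex.ofReal_mul]
    ring
  rw [UpperHalfPlane.coe_smul, UpperHalfPlane.coe_smul, ← map_sub, UpperHalfPlane.norm_σ, h]
  simp

instance isIsometricSMul_gl : IsIsometricSMul (GL (Fin 2) ℝ) ℍ := by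
  refine ⟨fun g => Isometry.of_dist_eq fun z w => ?_⟩
  have hz := norm_ne_zero_iff.mpr (UpperHalfPlane.denom_ne_zero g z)
  have hw := norm_ne_zero_iff.mpr (UpperHalfPlane.denom_ne_zero g w)
  have hdet : |g.det.val| ≠ 0 := abs_ne_zero.mpr g.det_ne_zero
  have hcosh : Real.cosh (dist (g • z) (g • w)) = Real.cosh (dist z w) := by
    rw [UpperHalfPlane.cosh_dist, UpperHalfPlane.cosh_dist, dist_eq_norm, dist_eq_norm,
      norm_coe_gl_smul_sub_coe_gl_smul, UpperHalfPlane.im_smul_eq_div_normSq,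
      UpperHalfPlane.im_smul_eq_div_normSq, Complex.normSq_eq_norm_sq, Complex.normSq_eq_norm_sq]
    field_simp
  exact Real.cosh_strictMonoOn.injOn dist_nonneg dist_nonneg hcosh

variable {g : GL (Fin 2) ℝ}

theorem cosh_dist_gl_smul (hg : 0 < g.det.val) (z : ℍ) :
    Real.cosh (dist z (g • z)) =
      1 + ‖aeval (z : ℂ) g.fixpointPolynomial‖ ^ 2 / (2 * g.det.val * z.im ^ 2) := by
  have hd := UpperHalfPlane.denom_ne_zero g z
  have hsub : (z : ℂ) - (g • z : ℍ) =
      aeval (z : ℂ) g.fixpointPolynomial / UpperHalfPlane.denom g z := by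
    rw [UpperHalfPlane.coe_smul_of_det_pos hg, eq_div_iff hd, sub_mul, div_mul_cancel₀ _ hd]
    simp only [UpperHalfPlane.num, UpperHalfPlane.denom, GeneralLinearGroup.fixpointPolynomial,
      map_sub, map_add, map_mul, map_pow, Polynomial.aeval_C, Polynomial.aeval_X,
      Complex.coe_algebraMap]
    ring
  rw [UpperHalfPlane.cosh_dist, dist_eq_norm, hsub, UpperHalfPlane.im_smul_eq_div_normSq,
    Complex.normSq_eq_norm_sq, abs_of_pos hg, norm_div]
  have hd' := norm_ne_zero_iff.mpr hd
  field_simp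

theorem det_mul_cosh_dist_gl_smul_smul (hg : 0 < g.det.val) (z : ℍ) :
    g.det.val * (Real.cosh (dist z (g • g • z)) - 1) =
      g.val.trace ^ 2 * (Real.cosh (dist z (g • z)) - 1) := by
  have hgg : 0 < (g * g).det.val := by simpa using mul_pos hg hg
  rw [smul_smul, cosh_dist_gl_smul hgg, cosh_dist_gl_smul hg, fixpointPolynomial_mul_self]
  simp only [map_mul, Polynomial.aeval_C, norm_mul, Complex.coe_algebraMap, Complex.norm_real,
    Real.norm_eq_abs, mul_pow, sq_abs, Units.val_mul, add_sub_cancel_left]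
  field_simp

theorem discr_eq_of_dist_smul_smul (hg : 0 < g.det.val) {z : ℍ} (hz : g • z ≠ z)
    (h : dist z (g • g • z) = 2 * dist z (g • z)) :
    g.val.discr = 2 * g.det.val * (Real.cosh (dist z (g • z)) - 1) := by
  have hcosh : Real.cosh (dist z (g • z)) - 1 ≠ 0 :=
    (sub_pos.mpr (Real.one_lt_cosh.mpr (dist_ne_zero.mpr hz.symm))).ne'
  have key := det_mul_cosh_dist_gl_smul_smul hg z
  rw [h, Real.cosh_two_mul, Real.sinh_sq] at key
  rw [discr_fin_two, ← GeneralLinearGroup.val_det_apply]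
  refine mul_right_cancel₀ hcosh ?_
  linear_combination -key

theorem isHyperbolic_of_dist_smul_smul {z : ℍ} (hz : g • z ≠ z)
    (h : dist z (g • g • z) = 2 * dist z (g • z)) : g.IsHyperbolic := by
  rw [GeneralLinearGroup.IsHyperbolic, IsHyperbolic]
  rcases g.det_ne_zero.lt_or_gt with hneg | hpos
  · rw [discr_fin_two]
    linarith [sq_nonneg g.val.trace]
  · rw [discr_eq_of_dist_smul_smul hpos hz h]
    have := Real.one_lt_cosh.mpr (dist_ne_zero.mpr hz.symm)
    exact mul_pos (mul_pos two_pos hpos) (sub_pos.mpr this)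

theorem isHyperbolic_of_smul_eq_translate {c : ℝ → ℍ} (hc : IsGeodesicLine c) {L : ℝ}
    (hL : L ≠ 0) (h : ∀ t, g • c t = c (t + L)) : g.IsHyperbolic := by
  refine isHyperbolic_of_dist_smul_smul (z := c 0) ?_ ?_
  · simpa [h, hc.injective.eq_iff] using hL
  · simp only [h, hc.dist_eq]
    simp [← two_mul]

end Displacement

section Companion

/-- The companion matrix of `X ^ 2 - T * X + 1`, as an element of `SL(2, R)`: the normal form, up to
conjugation over a field, of a matrix of determinant `1` and trace `T`. -/
def companion {R : Type*} [CommRing R] (T : R) : SL(2, R) :=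
  ⟨!![0, -1; 1, T], by simp [det_fin_two]⟩

@[simp]
theorem coe_companion {R : Type*} [CommRing R] (T : R) : (companion T).val = !![0, -1; 1, T] :=
  rfl

theorem exists_semiconjBy_companion {R : Type*} (K : Type*) [CommRing R] [Field K] [Algebra R K]
    [FaithfulSMul R K] {g : SL(2, R)} (hg : g 1 0 ≠ 0) :
    ∃ p : GL (Fin 2) K, SemiconjBy p (mapGL K g) (mapGL K (companion g.val.trace)) := by
  have hc : algebraMap R K (g 1 0) ≠ 0 := by simpa
  refine ⟨.mkOfDetNeZero !![algebraMap R K (g 1 0), -algebraMap R K (g 0 0); 0, 1]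
    (by simpa [det_fin_two] using hc), ?_⟩
  have hdet : g 0 0 * g 1 1 - g 0 1 * g 1 0 = 1 := by rw [← det_fin_two, g.det_coe]
  have hdet' := congrArg (algebraMap R K) hdet
  simp only [map_sub, map_mul, map_one] at hdet'
  ext i j
  fin_cases i <;> fin_cases j <;>
    simp [GeneralLinearGroup.mkOfDetNeZero, Matrix.mul_apply, trace_fin_two]
  · ring
  · linear_combination -hdet'

theorem apply_one_zero_ne_zero_of_isHyperbolic {g : SL(2, ℤ)} (hg : g.val.IsHyperbolic) :
    g 1 0 ≠ 0 := by
  intro hc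
  have hdet : g 0 0 * g 1 1 - g 0 1 * g 1 0 = 1 := by rw [← det_fin_two, g.det_coe]
  rw [hc, mul_zero, sub_zero] at hdet
  rw [IsHyperbolic, discr_fin_two, trace_fin_two, g.det_coe] at hg
  rcases Int.eq_one_or_neg_one_of_mul_eq_one' hdet with ⟨h, h'⟩ | ⟨h, h'⟩ <;>
    simp [h, h'] at hg

end Companion

theorem closedGeodesicLengths_subset_of_semiconjBy {g h : SL(2, ℤ)} {p : GL (Fin 2) ℝ}
    (hp : SemiconjBy p (mapGL ℝ g) (mapGL ℝ h)) :
    closedGeodesicLengths (g : PSL(2, ℤ)) ⊆ closedGeodesicLengths (h : PSL(2, ℤ)) := by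
  rintro L ⟨hL, c, hc, hgc⟩
  refine ⟨hL, fun t => p • c t, (isometry_smul ℍ p).comp hc, fun t => ?_⟩
  calc mapGL ℝ h • p • c t = p • mapGL ℝ g • c t := by rw [smul_smul, ← hp.eq, mul_smul]
    _ = p • c (t + L) := congrArg (p • ·) (hgc t)

theorem isHyperbolic_of_mem_closedGeodesicLengths {g : SL(2, ℤ)} {L : ℝ}
    (hL : L ∈ closedGeodesicLengths (g : PSL(2, ℤ))) : g.val.IsHyperbolic := by
  obtain ⟨hpos, c, hc, h⟩ := hL
  have hg : (mapGL ℝ g).IsHyperbolic := isHyperbolic_of_smul_eq_translate hc hpos.ne' h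
  have hdiscr : (mapGL ℝ g).val.discr = g.val.discr := discr_map (algebraMap ℤ ℝ) g.val
  rw [GeneralLinearGroup.IsHyperbolic, IsHyperbolic, hdiscr] at hg
  exact Int.cast_pos.mp hg

theorem closedGeodesicLengths_subset_primitiveLengthSpectrum (γ : PSL(2, ℤ)) :
    closedGeodesicLengths γ ⊆ primitiveLengthSpectrum := by
  intro L hL
  obtain ⟨g, rfl⟩ := QuotientGroup.mk_surjective γ
  have hg : g.val.IsHyperbolic := isHyperbolic_of_mem_closedGeodesicLengths hL
  obtain ⟨p, hp⟩ := exists_semiconjBy_companion ℝ (apply_one_zero_ne_zero_of_isHyperbolic hg)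
  have hL' := closedGeodesicLengths_subset_of_semiconjBy hp hL
  exact ⟨_, isPrimitiveElement_coe (isHyperbolic_of_mem_closedGeodesicLengths hL')
    (by simp), hL'⟩

theorem pow_smul_eq_translate {M T α : Type*} [Monoid M] [MulAction M α] [AddMonoid T] {a : M}
    {c : T → α} {L : T} (h : ∀ t, a • c t = c (t + L)) (n : ℕ) (t : T) :
    a ^ n • c t = c (t + n • L) := by
  induction n generalizing t with
  | zero => simp
  | succ n ih => rw [pow_succ, mul_smul, h, ih, succ_nsmul', add_assoc]

theorem nat_mul_mem_closedGeodesicLengths {γ : PSL(2, ℤ)} {L : ℝ}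
    (hL : L ∈ closedGeodesicLengths γ) {n : ℕ} (hn : 0 < n) :
    n * L ∈ closedGeodesicLengths (γ ^ n) := by
  obtain ⟨hpos, c, hc, h⟩ := hL
  exact ⟨by positivity, c, hc, by simpa using pow_smul_eq_translate h n⟩

end ModularSurface

theorem mainTheorem10_general {γ : PSL(2, ℤ)} {ℓ : ℝ}
    (hℓ : ℓ ∈ ModularSurface.closedGeodesicLengths γ) {n : ℕ} (hn : 0 < n) :
    n * ℓ ∈ ModularSurface.primitiveLengthSpectrum :=
  ModularSurface.closedGeodesicLengths_subset_primitiveLengthSpectrum (γ ^ n)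
    (ModularSurface.nat_mul_mem_closedGeodesicLengths hℓ hn)

theorem mainTheorem10 (ℓ : ℝ) (hℓ : ℓ ∈ ModularSurface.primitiveLengthSpectrum) (k : ℕ) :
    ∃ C : ℕ, 0 < C ∧
      ∀ n ∈ Finset.Icc 1 k, (C : ℝ) * n * ℓ ∈ ModularSurface.primitiveLengthSpectrum := by
  obtain ⟨γ, -, hγ⟩ := hℓ
  exact ⟨1, one_pos, fun n hn => by simpa using mainTheorem10_general hγ (Finset.mem_Icc.mp hn).1⟩
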